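/- Let $\mathcal X$ and $\mathcal Y$ be separable Hilbert spaces (over $\mathbb R$ or over $\mathbb C$), and let $U$ be a bounded linear operator on $\mathcal X$ and $V$ a bounded linear operator on $\mathcal Y$. Below, "operator" means bounded linear operator, "invertible" means invertible with bounded inverse, and $\oplus$ denotes the topological direct sum. Then the following three statements are equivalent. (SC) $U$ and $V$ are Schur coupled: there is an operator matrix $\begin{pmatrix} A & B\\ C& D\end{pmatrix}$ on $\mathcal X\oplus\mathcal Y$ with $A$ and $D$ invertible such that $U=A-BD^{-1}C$ and $V=D-CA^{-1}B$. (MC) $U$ and $V$ are matricially coupled: there is an invertible operator $\widehat U=\begin{pmatrix} U_{11}&U_{12}\\U_{21}&U_{22}\end{pmatrix}$ on $\mathcal X\oplus\mathcal Y$ with inverse $\widehat U^{-1}=\begin{pmatrix} V_{11}&V_{12}\\V_{21}&V_{22}\end{pmatrix}$ such that $U=U_{11}$ and $V=V_{22}$. (EAE) $U$ and $V$ are equivalent after extension: there are Banach spaces $\mathcal X_0$ and $\mathcal Y_0$ and invertible operators $E:\mathcal Y\oplus\mathcal Y_0\to\mathcal X\oplus\mathcal X_0$ and $F:\mathcal X\oplus\mathcal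 X_0\to\mathcal Y\oplus\mathcal Y_0$ such that $$\begin{pmatrix} U&0\\0&I_{\mathcal X_0}\end{pmatrix}=E\begin{pmatrix} V&0\\0&I_{\mathcal Y_0}\end{pmatrix}F.$$ -/

import Mathlib

universe u

/-- The bounded operators `U` on `X` and `V` on `Y` are Schur coupled: there is an operator matrix
`[A B; C D]` on `X ∔ Y` with `A` and `D` (boundedly) invertible such that `U` is its Schur
complement `A - B D⁻¹ C` and `V` is its Schur complement `D - C A⁻¹ B`. -/
def SchurCoupled {𝕜 : Type*} [RCLike 𝕜] {X Y : Type*}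
    [NormedAddCommGroup X] [NormedSpace 𝕜 X] [NormedAddCommGroup Y] [NormedSpace 𝕜 Y]
    (U : X →L[𝕜] X) (V : Y →L[𝕜] Y) : Prop :=
  ∃ (A : X ≃L[𝕜] X) (B : Y →L[𝕜] X) (C : X →L[𝕜] Y) (D : Y ≃L[𝕜] Y),
    U = (A : X →L[𝕜] X) - B ∘L (D.symm : Y →L[𝕜] Y) ∘L C ∧
    V = (D : Y →L[𝕜] Y) - C ∘L (A.symm : X →L[𝕜] X) ∘L B

/-- The bounded operators `U` on `X` and `V` on `Y` are matricially coupled: there is an invertible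
operator `W` on `X ∔ Y` such that `U` is the upper left block of `W` and `V` is the lower right
block of the inverse of `W`. (The topological direct sum `X ∔ Y` is `X × Y`.) -/
def MatriciallyCoupled {𝕜 : Type*} [RCLike 𝕜] {X Y : Type*}
    [NormedAddCommGroup X] [NormedSpace 𝕜 X] [NormedAddCommGroup Y] [NormedSpace 𝕜 Y]
    (U : X →L[𝕜] X) (V : Y →L[𝕜] Y) : Prop :=
  ∃ W : (X × Y) ≃L[𝕜] (X × Y),
    U = ContinuousLinearMap.fst 𝕜 X Y ∘L (W : (X × Y) →L[𝕜] (X × Y)) ∘L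
      ContinuousLinearMap.inl 𝕜 X Y ∧
    V = ContinuousLinearMap.snd 𝕜 X Y ∘L (W.symm : (X × Y) →L[𝕜] (X × Y)) ∘L
      ContinuousLinearMap.inr 𝕜 X Y

/-- The bounded operators `U` on `X` and `V` on `Y` are equivalent after extension: there are
Banach spaces `X₀`, `Y₀` and invertible operators `E : Y ∔ Y₀ → X ∔ X₀`, `F : X ∔ X₀ → Y ∔ Y₀`
such that `U ⊕ I = E (V ⊕ I) F`. -/
def EquivalentAfterExtension {𝕜 : Type*} [RCLike 𝕜] {X Y : Type u}
    [NormedAddCommGroup X] [NormedSpace 𝕜 X] [NormedAddCommGroup Y] [NormedSpace 𝕜 Y]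
    (U : X →L[𝕜] X) (V : Y →L[𝕜] Y) : Prop :=
  ∃ (X₀ : Type u) (_ : NormedAddCommGroup X₀) (_ : NormedSpace 𝕜 X₀) (_ : CompleteSpace X₀)
    (Y₀ : Type u) (_ : NormedAddCommGroup Y₀) (_ : NormedSpace 𝕜 Y₀) (_ : CompleteSpace Y₀)
    (E : (Y × Y₀) ≃L[𝕜] (X × X₀)) (F : (X × X₀) ≃L[𝕜] (Y × Y₀)),
    U.prodMap (ContinuousLinearMap.id 𝕜 X₀) =
      (E : (Y × Y₀) →L[𝕜] (X × X₀)) ∘L V.prodMap (ContinuousLinearMap.id 𝕜 Y₀) ∘L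
        (F : (X × X₀) →L[𝕜] (Y × Y₀))

/-! (SC) ⇒ (MC) ⇔ (EAE) is block-matrix algebra; the content is (MC) ⇒ (SC). Let `W`, with first row
`(U, U₁₂)` and second row `(U₂₁, U₂₂)`, be a coupling operator. If `U₂₂` is invertible, a Schur
coupling can be read off (`schurCoupled_of_isInvertible_block`). The triangular multiplications of
`ContinuousLinearEquiv.exists_shear` keep `U` and `V` but replace `U₂₂` by `U₂₂ + U₂₁ Z + L (U₁₂ + U
Z)`, so the task is to choose `L` and `Z` making this invertible.

If `Y` is finite-dimensional, `Z = 0` suffices by rank-nullity; finite-dimensional `X` follows by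
symmetry.

If both spaces are infinite-dimensional, a preliminary shear makes `U₁₂` and `U₂₁` noncompact. The
identity of `Y` factors through any noncompact operator, so some `Z` makes a right invertible
operator annihilate `S = U₂₂ + U₂₁ Z` while `T = U₁₂ + U Z` stays noncompact. The room left by the
range of `S` lets a multiple of `T` make `S` left invertible, and a further multiple makes it
invertible (`exists_equiv_add_comp_of_leftInverse`). -/

open scoped InnerProductSpace

/-! ### Separable Hilbert spaces: countable bases and uniqueness. -/

/-- A separable infinite-dimensional Hilbert space has a Hilbert basis indexed by `ℕ`. -/
theorem exists_hilbertBasis_nat (𝕜 : Type*) [RCLike 𝕜] (H : Type*) [NormedAddCommGroup H]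
    [InnerProductSpace 𝕜 H] [CompleteSpace H] [TopologicalSpace.SeparableSpace H]
    (hH : ¬ FiniteDimensional 𝕜 H) : Nonempty (HilbertBasis ℕ 𝕜 H) := by
  obtain ⟨w, b, hb⟩ := exists_hilbertBasis 𝕜 H
  -- Orthonormal vectors lie at distance √2, so the basis is a discrete subset of a separable space,
  -- hence countable.
  have hsep : ∀ i j : w, i ≠ j → 1 ≤ dist i j := by
    intro i j hij
    have h0 : ⟪b i, b j⟫_𝕜 = 0 := b.orthonormal.2 hij
    have h1 : dist i j = ‖b i - b j‖ := by rw [hb, ← dist_eq_norm]; rfl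
    have h2 : ‖b i - b j‖ * ‖b i - b j‖ = 1 + 1 := by
      rw [@norm_sub_mul_self 𝕜, h0, b.orthonormal.1 i, b.orthonormal.1 j]; simp
    rw [h1]
    nlinarith [norm_nonneg (b i - b j)]
  have : SecondCountableTopology H := UniformSpace.secondCountable_of_separable H
  have : DiscreteTopology w := DiscreteTopology.of_forall_le_dist one_pos (fun i j h => hsep i j h)
  have : Countable w := countable_of_Lindelof_of_discrete
  have : Infinite w := by
    by_contra h
    rw [not_infinite_iff_finite] at h
    have := Fintype.ofFinite w
    exact hH (b.toOrthonormalBasis.toBasis.finiteDimensional_of_finite)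
  obtain ⟨e⟩ : Nonempty (w ≃ ℕ) := nonempty_equiv_of_countable
  refine ⟨HilbertBasis.mk (v := fun n => b (e.symm n)) (b.orthonormal.comp _ e.symm.injective) ?_⟩
  have : Set.range (fun n => b (e.symm n)) = Set.range b := e.symm.surjective.range_comp b
  rw [this, b.dense_span]

/-- Any two separable infinite-dimensional Hilbert spaces are isometrically isomorphic. -/
theorem nonempty_linearIsometryEquiv_of_separable {𝕜 : Type*} [RCLike 𝕜] {H K : Type*}
    [NormedAddCommGroup H] [InnerProductSpace 𝕜 H] [CompleteSpace H]
    [TopologicalSpace.SeparableSpace H] [NormedAddCommGroup K] [InnerProductSpace 𝕜 K]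
    [CompleteSpace K] [TopologicalSpace.SeparableSpace K]
    (hH : ¬ FiniteDimensional 𝕜 H) (hK : ¬ FiniteDimensional 𝕜 K) : Nonempty (H ≃ₗᵢ[𝕜] K) := by
  obtain ⟨b⟩ := exists_hilbertBasis_nat 𝕜 H hH
  obtain ⟨c⟩ := exists_hilbertBasis_nat 𝕜 K hK
  exact ⟨b.repr.trans c.repr.symm⟩

theorem IsCompactOperator.of_forall_eq {M N : Type*} [Zero M] [TopologicalSpace M]
    [TopologicalSpace N] {f g : M → N} (hf : IsCompactOperator f) (h : ∀ x, f x = g x) :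
    IsCompactOperator g :=
  funext h ▸ hf

/-! ### Noncompact operators and factorization of the identity. -/

section Hilbert

variable {𝕜 : Type*} [RCLike 𝕜] {H K G : Type*}
  [NormedAddCommGroup H] [InnerProductSpace 𝕜 H]
  [NormedAddCommGroup K] [InnerProductSpace 𝕜 K] [CompleteSpace K]
  [NormedAddCommGroup G] [InnerProductSpace 𝕜 G] [CompleteSpace G]

/-- A bounded operator that is small on the orthogonal complements of suitable finite-dimensional
subspaces is compact. -/
theorem isCompactOperator_of_forall_exists_finiteDimensional (A : H →L[𝕜] K)
    (h : ∀ δ > 0, ∃ F : Submodule 𝕜 H, FiniteDimensional 𝕜 F ∧ ∀ x ∈ Fᗮ, ‖A x‖ ≤ δ * ‖x‖) :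
    IsCompactOperator A := by
  have hcl := isClosed_setOfPred_isCompactOperator (σ₁₂ := RingHom.id 𝕜) (M₁ := H) (M₂ := K)
  have hmem : A ∈ closure {f : H →L[𝕜] K | IsCompactOperator f} := by
    rw [Metric.mem_closure_iff]
    intro ε hε
    obtain ⟨F, hF, hA⟩ := h (ε / 2) (by positivity)
    -- Cutting `A` down to `F` gives a finite-rank approximant, and compact operators form a closed
    -- set.
    refine ⟨(A ∘L F.subtypeL) ∘L F.orthogonalProjectionOnto, ?_, ?_⟩
    · have : ProperSpace F := FiniteDimensional.proper_rclike 𝕜 F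
      exact (isCompactOperator_of_locallyCompactSpace_rng (A ∘L F.subtypeL)).comp_clm
        F.orthogonalProjectionOnto
    · rw [dist_eq_norm]
      refine lt_of_le_of_lt (ContinuousLinearMap.opNorm_le_bound _ (by positivity) fun x => ?_)
        (half_lt_self hε)
      have hx : ‖x - F.starProjection x‖ ≤ ‖x‖ := by
        rw [← F.starProjection_orthogonal_val x]
        simpa using Fᗮ.starProjection.le_of_opNorm_le Fᗮ.starProjection_norm_le x
      calc _ = ‖A (x - F.starProjection x)‖ := by rw [map_sub]; rfl
        _ ≤ ε / 2 * ‖x - F.starProjection x‖ := hA _ (F.sub_starProjection_mem_orthogonal x)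
        _ ≤ _ := by gcongr
  rwa [hcl.closure_eq] at hmem

variable [CompleteSpace H]

/-- A noncompact operator is bounded below on an orthonormal sequence that it maps to an orthogonal
sequence. -/
theorem exists_orthonormal_seq_of_not_isCompactOperator (A : H →L[𝕜] K)
    (hA : ¬ IsCompactOperator A) :
    ∃ δ > 0, ∃ e : ℕ → H, Orthonormal 𝕜 e ∧ (∀ n, δ ≤ ‖A (e n)‖) ∧
      Pairwise fun m n => ⟪A (e m), A (e n)⟫_𝕜 = 0 := by
  obtain ⟨δ, hδ, hF⟩ : ∃ δ > 0, ∀ F : Submodule 𝕜 H, FiniteDimensional 𝕜 F →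
      ∃ x ∈ Fᗮ, δ * ‖x‖ < ‖A x‖ := by
    by_contra! hcon
    exact hA (isCompactOperator_of_forall_exists_finiteDimensional A hcon)
  have step : ∀ s : Finset H, (∀ x ∈ s, ‖x‖ = 1 ∧ δ ≤ ‖A x‖) →
      ∃ y, (‖y‖ = 1 ∧ δ ≤ ‖A y‖) ∧ ∀ x ∈ s, ⟪x, y⟫_𝕜 = 0 ∧ ⟪A x, A y⟫_𝕜 = 0 := by
    classical
    intro s _
    -- Orthogonality to `A* A x` is what makes the images under `A` orthogonal.
    let t : Finset H := s ∪ s.image fun x => A.adjoint (A x)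
    obtain ⟨x, hx, hxA⟩ := hF (Submodule.span 𝕜 (t : Set H)) (FiniteDimensional.span_finset 𝕜 t)
    have hx0 : x ≠ 0 := by rintro rfl; simp at hxA
    have hn : 0 < ‖x‖ := norm_pos_iff.2 hx0
    have ht : ∀ z ∈ t, ⟪z, x⟫_𝕜 = 0 := fun z hz =>
      (Submodule.mem_orthogonal _ _).1 hx z (Submodule.subset_span hz)
    refine ⟨((‖x‖⁻¹ : ℝ) : 𝕜) • x, ⟨?_, ?_⟩, fun z hz => ⟨?_, ?_⟩⟩
    · rw [norm_smul]; simp [hn.ne']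
    · rw [map_smul, norm_smul]
      simp only [RCLike.norm_ofReal, abs_inv, abs_norm]
      rw [inv_mul_eq_div, le_div_iff₀ hn]
      exact hxA.le
    · rw [inner_smul_right, ht z (by simp [t, hz]), mul_zero]
    · rw [map_smul, inner_smul_right, ← ContinuousLinearMap.adjoint_inner_left,
        ht _ (by simp only [t, Finset.mem_union, Finset.mem_image]; exact Or.inr ⟨z, hz, rfl⟩),
        mul_zero]
  obtain ⟨e, he, hr⟩ := exists_seq_of_forall_finset_exists _ _ step
  refine ⟨δ, hδ, e, ⟨fun n => (he n).1, fun m n hmn => ?_⟩, fun n => (he n).2, fun m n hmn => ?_⟩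
  · rcases lt_or_gt_of_ne hmn with h | h
    · exact (hr m n h).1
    · exact inner_eq_zero_symm.1 (hr n m h).1
  · rcases lt_or_gt_of_ne hmn with h | h
    · exact (hr m n h).2
    · exact inner_eq_zero_symm.1 (hr n m h).2

/-- An operator bounded below on a Hilbert space has a bounded left inverse. -/
theorem ContinuousLinearMap.exists_leftInverse_of_bounded_below (T : G →L[𝕜] K) {δ : ℝ}
    (hδ : 0 < δ) (h : ∀ x, δ * ‖x‖ ^ 2 ≤ ‖T x‖ ^ 2) : ∃ R : K →L[𝕜] G, ∀ x, R (T x) = x := by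
  have hu : IsUnit (T.adjoint ∘L T) := by
    refine ContinuousLinearMap.isUnit_of_forall_le_norm_inner_map _ (c := ⟨δ, hδ.le⟩) hδ fun x => ?_
    rw [ContinuousLinearMap.comp_apply, ContinuousLinearMap.adjoint_inner_left,
      inner_self_eq_norm_sq_to_K, norm_pow, RCLike.norm_ofReal, abs_norm, mul_comm]
    exact h x
  obtain ⟨u, hu⟩ := hu
  -- The left inverse is `(T* T)⁻¹ T*`.
  refine ⟨(↑u⁻¹ : G →L[𝕜] G) ∘L T.adjoint, fun x => ?_⟩
  have : (↑u⁻¹ : G →L[𝕜] G) * (T.adjoint ∘L T) = 1 := by rw [← hu, Units.inv_mul]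
  exact congrArg (fun f : G →L[𝕜] G => f x) this

/-- The identity of a separable infinite-dimensional Hilbert space factors through every noncompact
operator between Hilbert spaces. -/
theorem exists_factorization_id_of_not_isCompactOperator [TopologicalSpace.SeparableSpace G]
    (hG : ¬ FiniteDimensional 𝕜 G) (A : H →L[𝕜] K) (hA : ¬ IsCompactOperator A) :
    ∃ (P : G →L[𝕜] H) (R : K →L[𝕜] G), ∀ x, R (A (P x)) = x := by
  obtain ⟨δ, hδ, e, he, heA, horth⟩ := exists_orthonormal_seq_of_not_isCompactOperator A hA
  obtain ⟨b⟩ := exists_hilbertBasis_nat 𝕜 G hG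
  classical
  let V : G →L[𝕜] H := he.orthogonalFamily.linearIsometry.toContinuousLinearMap ∘L
    (b.repr.toContinuousLinearEquiv : G →L[𝕜] _)
  have hV : ∀ n, V (b n) = e n := by
    intro n
    change he.orthogonalFamily.linearIsometry (b.repr (b n)) = e n
    rw [b.repr_self, he.orthogonalFamily.linearIsometry_apply_single]
    simp
  let T : G →L[𝕜] K := A ∘L V
  have hT : ∀ n, T (b n) = A (e n) := fun n => by simp [T, hV]
  have hb_ext : ∀ y z : G, (∀ j, ⟪b j, y⟫_𝕜 = ⟪b j, z⟫_𝕜) → y = z := by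
    intro y z hyz
    apply b.repr.injective
    ext j
    rw [b.repr_apply_apply, b.repr_apply_apply, hyz j]
  -- `T* T` is diagonal in the basis `b` with entries at least `δ ^ 2`, so Parseval bounds `T` from
  -- below.
  have hTT : ∀ n, T.adjoint (T (b n)) = ((‖A (e n)‖ ^ 2 : ℝ) : 𝕜) • b n := by
    intro n
    refine hb_ext _ _ fun j => ?_
    rw [ContinuousLinearMap.adjoint_inner_right, hT, hT, inner_smul_right]
    by_cases hjn : j = n
    · subst hjn
      rw [inner_self_eq_norm_sq_to_K, inner_self_eq_norm_sq_to_K, b.orthonormal.1 j]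
      simp
    · rw [horth hjn, b.orthonormal.2 hjn, mul_zero]
  have hbound : ∀ x, δ ^ 2 * ‖x‖ ^ 2 ≤ ‖T x‖ ^ 2 := by
    intro x
    have h1 := b.hasSum_inner_mul_inner (T.adjoint (T x)) x
    have h2 := b.hasSum_inner_mul_inner x x
    rw [ContinuousLinearMap.adjoint_inner_left] at h1
    have e1 : ∀ n, ⟪T.adjoint (T x), b n⟫_𝕜 * ⟪b n, x⟫_𝕜 =
        ((‖A (e n)‖ ^ 2 * ‖⟪b n, x⟫_𝕜‖ ^ 2 : ℝ) : 𝕜) := by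
      intro n
      rw [ContinuousLinearMap.adjoint_inner_left, ← ContinuousLinearMap.adjoint_inner_right, hTT,
        inner_smul_right, mul_assoc, ← inner_conj_symm x (b n), RCLike.conj_mul]
      push_cast; rfl
    have e2 : ∀ n, ⟪x, b n⟫_𝕜 * ⟪b n, x⟫_𝕜 = ((‖⟪b n, x⟫_𝕜‖ ^ 2 : ℝ) : 𝕜) := by
      intro n
      rw [← inner_conj_symm x (b n), RCLike.conj_mul]
      push_cast; rfl
    simp only [e1, inner_self_eq_norm_sq_to_K] at h1
    simp only [e2, inner_self_eq_norm_sq_to_K] at h2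
    have h1' : HasSum (fun n => ‖A (e n)‖ ^ 2 * ‖⟪b n, x⟫_𝕜‖ ^ 2) (‖T x‖ ^ 2) := by
      rw [← RCLike.hasSum_ofReal 𝕜]; exact_mod_cast h1
    have h2' : HasSum (fun n => ‖⟪b n, x⟫_𝕜‖ ^ 2) (‖x‖ ^ 2) := by
      rw [← RCLike.hasSum_ofReal 𝕜]; exact_mod_cast h2
    refine hasSum_le (fun n => ?_) (h2'.mul_left (δ ^ 2)) h1'
    have := heA n
    gcongr
  obtain ⟨R, hR⟩ := T.exists_leftInverse_of_bounded_below (by positivity) hbound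
  exact ⟨V, R, hR⟩

end Hilbert

/-! ### Block-matrix algebra of the three relations. -/

section Algebra

variable {𝕜 : Type*} [RCLike 𝕜] {X Y : Type*}
  [NormedAddCommGroup X] [NormedSpace 𝕜 X] [NormedAddCommGroup Y] [NormedSpace 𝕜 Y]
  {U : X →L[𝕜] X} {V : Y →L[𝕜] Y}

theorem SchurCoupled.symm (h : SchurCoupled U V) : SchurCoupled V U := by
  obtain ⟨A, B, C, D, hU, hV⟩ := h
  exact ⟨D, C, B, A, hV, hU⟩

theorem MatriciallyCoupled.symm (h : MatriciallyCoupled U V) : MatriciallyCoupled V U := by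
  obtain ⟨W, hU, hV⟩ := h
  refine ⟨(ContinuousLinearEquiv.prodComm 𝕜 Y X).trans
    (W.symm.trans (ContinuousLinearEquiv.prodComm 𝕜 X Y)), ?_, ?_⟩
  · rw [hV]; ext y; rfl
  · rw [hU]; ext x; rfl

/-- Partial inversion: if `[A B; C D]` sends `(x, z)` to `(u, v)`, the coupling operator sends `(x,
-v)` to `(u, -z)`. Solving for `z` uses `D⁻¹`; going back uses `A⁻¹`. -/
theorem SchurCoupled.matriciallyCoupled (h : SchurCoupled U V) : MatriciallyCoupled U V := by
  obtain ⟨A, B, C, D, rfl, rfl⟩ := h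
  refine ⟨ContinuousLinearEquiv.equivOfInverse
    (((A : X →L[𝕜] X) - B ∘L (D.symm : Y →L[𝕜] Y) ∘L C).coprod (-(B ∘L (D.symm : Y →L[𝕜] Y)))
      |>.prod (((D.symm : Y →L[𝕜] Y) ∘L C).coprod (D.symm : Y →L[𝕜] Y)))
    ((A.symm : X →L[𝕜] X).coprod ((A.symm : X →L[𝕜] X) ∘L B)
      |>.prod ((-(C ∘L (A.symm : X →L[𝕜] X))).coprod
        ((D : Y →L[𝕜] Y) - C ∘L (A.symm : X →L[𝕜] X) ∘L B))) ?_ ?_, ?_, ?_⟩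
  · rintro ⟨x, y⟩
    ext <;> simp <;> abel
  · rintro ⟨x, y⟩
    ext <;> simp <;> abel
  · ext x; simp
  · ext y; simp

theorem MatriciallyCoupled.equivalentAfterExtension {X Y : Type u}
    [NormedAddCommGroup X] [NormedSpace 𝕜 X] [CompleteSpace X]
    [NormedAddCommGroup Y] [NormedSpace 𝕜 Y] [CompleteSpace Y]
    {U : X →L[𝕜] X} {V : Y →L[𝕜] Y} (h : MatriciallyCoupled U V) :
    EquivalentAfterExtension U V := by
  obtain ⟨W, rfl, rfl⟩ := h
  let U₂₁ : X →L[𝕜] Y := ContinuousLinearMap.snd 𝕜 X Y ∘L (W : (X × Y) →L[𝕜] (X × Y)) ∘L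
    ContinuousLinearMap.inl 𝕜 X Y
  let V₁₂ : Y →L[𝕜] X := ContinuousLinearMap.fst 𝕜 X Y ∘L (W.symm : (X × Y) →L[𝕜] (X × Y)) ∘L
    ContinuousLinearMap.inr 𝕜 X Y
  let F : (X × Y) ≃L[𝕜] (Y × X) :=
    ((ContinuousLinearEquiv.refl 𝕜 X).skewProd (ContinuousLinearEquiv.refl 𝕜 Y) (-U₂₁)).trans
      ((ContinuousLinearEquiv.prodComm 𝕜 X Y).trans
        ((ContinuousLinearEquiv.refl 𝕜 Y).skewProd (ContinuousLinearEquiv.refl 𝕜 X) V₁₂))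
  refine ⟨Y, inferInstance, inferInstance, inferInstance, X, inferInstance, inferInstance,
    inferInstance, (ContinuousLinearEquiv.prodComm 𝕜 Y X).trans W, F,
    ContinuousLinearMap.ext fun p => ?_⟩
  obtain ⟨x, y⟩ := p
  -- With `w = y - U₂₁ x`, the vector fed to `W` is `(x, 0) + W⁻¹ (0, w)`, whose image is `(U x, U₂₁
  -- x + w) = (U x, y)`.
  have key : ((x + (W.symm (0, y + -(W (x, 0)).2)).1, (W.symm (0, y + -(W (x, 0)).2)).2) : X × Y) =
      (x, 0) + W.symm (0, y + -(W (x, 0)).2) := by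
    ext <;> simp
  change ((W (x, 0)).1, y) =
    W (x + (W.symm (0, y + -(W (x, 0)).2)).1, (W.symm (0, y + -(W (x, 0)).2)).2)
  rw [key, map_add, W.apply_symm_apply]
  ext <;> simp

theorem EquivalentAfterExtension.matriciallyCoupled {X Y : Type u}
    [NormedAddCommGroup X] [NormedSpace 𝕜 X] [NormedAddCommGroup Y] [NormedSpace 𝕜 Y]
    {U : X →L[𝕜] X} {V : Y →L[𝕜] Y} (h : EquivalentAfterExtension U V) :
    MatriciallyCoupled U V := by
  obtain ⟨X₀, _, _, _, Y₀, _, _, _, E, F, h⟩ := h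
  have h1 : ∀ p : X × X₀, E (V (F p).1, (F p).2) = (U p.1, p.2) := fun p =>
    (congrArg (fun f : (X × X₀) →L[𝕜] (X × X₀) => f p) h).symm
  let E₁₁ : Y →L[𝕜] X := .fst 𝕜 X X₀ ∘L (E : (Y × Y₀) →L[𝕜] (X × X₀)) ∘L .inl 𝕜 Y Y₀
  let E₂₁ : Y →L[𝕜] X₀ := .snd 𝕜 X X₀ ∘L (E : (Y × Y₀) →L[𝕜] (X × X₀)) ∘L .inl 𝕜 Y Y₀
  let F₁₁ : X →L[𝕜] Y := .fst 𝕜 Y Y₀ ∘L (F : (X × X₀) →L[𝕜] (Y × Y₀)) ∘L .inl 𝕜 X X₀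
  let F₁₂ : X₀ →L[𝕜] Y := .fst 𝕜 Y Y₀ ∘L (F : (X × X₀) →L[𝕜] (Y × Y₀)) ∘L .inr 𝕜 X X₀
  let E'₁₁ : X →L[𝕜] Y := .fst 𝕜 Y Y₀ ∘L (E.symm : (X × X₀) →L[𝕜] (Y × Y₀)) ∘L .inl 𝕜 X X₀
  let E'₂₁ : X →L[𝕜] Y₀ := .snd 𝕜 Y Y₀ ∘L (E.symm : (X × X₀) →L[𝕜] (Y × Y₀)) ∘L .inl 𝕜 X X₀
  let F'₁₁ : Y →L[𝕜] X := .fst 𝕜 X X₀ ∘L (F.symm : (Y × Y₀) →L[𝕜] (X × X₀)) ∘L .inl 𝕜 Y Y₀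
  let F'₁₂ : Y₀ →L[𝕜] X := .fst 𝕜 X X₀ ∘L (F.symm : (Y × Y₀) →L[𝕜] (X × X₀)) ∘L .inr 𝕜 Y Y₀
  let W : (X × Y) →L[𝕜] (X × Y) := (U.coprod E₁₁).prod ((-F₁₁).coprod (F₁₂ ∘L E₂₁))
  let W' : (X × Y) →L[𝕜] (X × Y) := ((F'₁₂ ∘L E'₂₁).coprod (-F'₁₁)).prod (E'₁₁.coprod V)
  have hW : ∀ x y, W (x, y) = (U x + (E (y, 0)).1, -(F (x, 0)).1 + (F (0, (E (y, 0)).2)).1) :=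
    fun _ _ => rfl
  have hW' : ∀ x y, W' (x, y) =
      ((F.symm (0, (E.symm (x, 0)).2)).1 + -(F.symm (y, 0)).1, (E.symm (x, 0)).1 + V y) :=
    fun _ _ => rfl
  refine ⟨ContinuousLinearEquiv.equivOfInverse W W' ?_ ?_, ?_, ?_⟩
  · rintro ⟨x, y⟩
    set p := E (y, 0) with hp
    -- The entry `-p.2` is chosen so that adding `p` to `E (V g.1, g.2) = (U x, -p.2)` cancels the
    -- second component; `E⁻¹` then recovers `y + V g.1` and `g.2`.
    set g := F (x, -p.2) with hg
    have e1 : W (x, y) = (U x + p.1, -g.1) := by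
      have : g = F (x, 0) - F (0, p.2) := by rw [hg, ← map_sub]; simp
      rw [hW, this]
      ext <;> simp [hp]
      abel
    have e2 : E.symm (U x + p.1, 0) = (y + V g.1, g.2) := by
      have : ((U x + p.1, 0) : X × X₀) = (U x, -p.2) + p := by ext <;> simp
      rw [this, ← h1 (x, -p.2), map_add, E.symm_apply_apply, hp, E.symm_apply_apply, ← hg]
      ext <;> simp [add_comm]
    have e3 : F.symm (0, g.2) - F.symm (-g.1, 0) = (x, -p.2) := by
      rw [← map_sub, F.symm_apply_eq, ← hg]; simp
    rw [e1, hW', e2, ← sub_eq_add_neg, ← Prod.fst_sub, e3]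
    simp
  · rintro ⟨x, y⟩
    set r := E.symm (x, 0) with hr
    set f := F.symm (-y, r.2) with hf
    have hFf : F f = (-y, r.2) := by rw [hf, F.apply_symm_apply]
    have e1 : W' (x, y) = (f.1, r.1 + V y) := by
      have : f = F.symm (0, r.2) - F.symm (y, 0) := by rw [hf, ← map_sub]; simp
      rw [hW', this]
      ext <;> simp [hr, sub_eq_add_neg]
    have e2 : E (r.1 + V y, 0) = (x - U f.1, -f.2) := by
      have e : ((r.1 + V y, 0) : Y × Y₀) = r - (V (F f).1, (F f).2) := by
        rw [hFf]; ext <;> simp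
      rw [e, map_sub, h1, hr, E.apply_symm_apply]
      ext <;> simp
    have e3 : F (f.1, 0) - F (0, -f.2) = (-y, r.2) := by
      rw [← map_sub, ← hFf]; congr 1; ext <;> simp
    have e4 : -(F (f.1, 0)).1 + (F (0, -f.2)).1 = y := by
      have := congrArg Prod.fst e3
      rw [Prod.fst_sub] at this
      rw [neg_add_eq_sub, ← neg_sub, this, neg_neg]
    rw [e1, hW, e2, e4, add_sub_cancel]
  · ext x
    change U x = U x + (E (0, 0)).1
    rw [Prod.mk_zero_zero, map_zero, Prod.fst_zero, add_zero]
  · ext y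
    change V y = (E.symm (0, 0)).1 + V y
    rw [Prod.mk_zero_zero, map_zero, Prod.fst_zero, zero_add]

/-- Matricial coupling is preserved when the coupling operator is multiplied on the left by a lower
and on the right by an upper unipotent triangular operator. -/
theorem ContinuousLinearEquiv.exists_shear (W : (X × Y) ≃L[𝕜] (X × Y)) (L : X →L[𝕜] Y)
    (Z : Y →L[𝕜] X) : ∃ W' : (X × Y) ≃L[𝕜] (X × Y),
      (∀ x y, W' (x, y) = ((W (x + Z y, y)).1, (W (x + Z y, y)).2 + L (W (x + Z y, y)).1)) ∧
      ∀ y, (W'.symm (0, y)).2 = (W.symm (0, y)).2 := by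
  let R : (X × Y) ≃L[𝕜] (X × Y) := (ContinuousLinearEquiv.prodComm 𝕜 X Y).trans
    (((ContinuousLinearEquiv.refl 𝕜 Y).skewProd (ContinuousLinearEquiv.refl 𝕜 X) Z).trans
      (ContinuousLinearEquiv.prodComm 𝕜 Y X))
  let S : (X × Y) ≃L[𝕜] (X × Y) :=
    (ContinuousLinearEquiv.refl 𝕜 X).skewProd (ContinuousLinearEquiv.refl 𝕜 Y) L
  refine ⟨R.trans (W.trans S), fun x y => rfl, fun y => ?_⟩
  -- The inverse of the left factor fixes `(0, y)`, and that of the right factor leaves second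
  -- components alone.
  change (W.symm (0, y - L 0)).2 = (W.symm (0, y)).2
  simp

/-- A matricial coupling whose lower right block is invertible yields a Schur coupling. -/
theorem schurCoupled_of_isInvertible_block (W : (X × Y) ≃L[𝕜] (X × Y))
    (hU : ∀ x, (W (x, 0)).1 = U x) (hV : ∀ y, (W.symm (0, y)).2 = V y)
    (G : Y ≃L[𝕜] Y) (hG : ∀ y, G y = (W (0, y)).2) : SchurCoupled U V := by
  let U₁₂ : Y →L[𝕜] X := .fst 𝕜 X Y ∘L (W : (X × Y) →L[𝕜] (X × Y)) ∘L .inr 𝕜 X Y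
  let U₂₁ : X →L[𝕜] Y := .snd 𝕜 X Y ∘L (W : (X × Y) →L[𝕜] (X × Y)) ∘L .inl 𝕜 X Y
  let V₁₁ : X →L[𝕜] X := .fst 𝕜 X Y ∘L (W.symm : (X × Y) →L[𝕜] (X × Y)) ∘L .inl 𝕜 X Y
  have hW : ∀ x y, W (x, y) = (U x + U₁₂ y, U₂₁ x + G y) := by
    intro x y
    have : ((x, y) : X × Y) = (x, 0) + (0, y) := by simp
    rw [this, map_add, ← hU, hG]
    rfl
  -- The Schur complement of `G` in `W`; its inverse is the upper left block `V₁₁` of `W⁻¹`.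
  let A : X →L[𝕜] X := U - U₁₂ ∘L (G.symm : Y →L[𝕜] Y) ∘L U₂₁
  have hA : ∀ x, W (x, -G.symm (U₂₁ x)) = (A x, 0) := fun x => by
    rw [hW]; ext <;> simp [A, sub_eq_add_neg]
  have hV₁₁ : ∀ x, W (V₁₁ x, -G.symm (U₂₁ (V₁₁ x))) = (x, 0) := by
    intro x
    have h1 : W (V₁₁ x, (W.symm (x, 0)).2) = (x, 0) := W.apply_symm_apply (x, 0)
    have h2 : U₂₁ (V₁₁ x) + G (W.symm (x, 0)).2 = 0 := by
      have := congrArg Prod.snd h1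
      rwa [hW] at this
    have h3 : (W.symm (x, 0)).2 = -G.symm (U₂₁ (V₁₁ x)) := by
      rw [← map_neg, ContinuousLinearEquiv.eq_symm_apply]
      exact eq_neg_of_add_eq_zero_right h2
    rwa [← h3]
  let A' : X ≃L[𝕜] X := ContinuousLinearEquiv.equivOfInverse A V₁₁
    (fun x => by
      change (W.symm (A x, 0)).1 = x
      rw [← hA, W.symm_apply_apply])
    (fun x => congrArg Prod.fst ((hA _).symm.trans (hV₁₁ x)))
  refine ⟨A', -(U₁₂ ∘L (G.symm : Y →L[𝕜] Y)), (G.symm : Y →L[𝕜] Y) ∘L U₂₁, G.symm, ?_, ?_⟩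
  · ext x
    simp [A', A]
  · ext y
    have h1 : W.symm (0, y) = (-V₁₁ (U₁₂ (G.symm y)),
        G.symm y + G.symm (U₂₁ (V₁₁ (U₁₂ (G.symm y))))) := by
      rw [W.symm_apply_eq]
      have h2 := hV₁₁ (U₁₂ (G.symm y))
      rw [hW] at h2
      have h3 := congrArg Prod.fst h2
      simp only [map_neg] at h3
      rw [hW]
      ext
      · have h4 : U (V₁₁ (U₁₂ (G.symm y))) + -U₁₂ (G.symm (U₂₁ (V₁₁ (U₁₂ (G.symm y))))) -
            U₁₂ (G.symm y) = 0 := sub_eq_zero.2 h3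
        rw [← neg_eq_zero] at h4
        simp only [map_neg, map_add]
        rw [← h4]; abel
      · simp
    have h4 : (A'.symm : X →L[𝕜] X) = V₁₁ := rfl
    rw [← hV, h1, h4]
    simp

end Algebra

/-! ### Completion to an invertible operator in finite dimension. -/

/-- An endomorphism `S` of a finite-dimensional space admits a correction that is supported on its
kernel and takes values in a complement of its range. -/
theorem LinearMap.exists_ker_correction {𝕜 V : Type*} [Field 𝕜] [AddCommGroup V] [Module 𝕜 V]
    [FiniteDimensional 𝕜 V] (S : V →ₗ[𝕜] V) :
    ∃ J : V →ₗ[𝕜] V, (∀ x z, S x + J z = 0 → S x = 0 ∧ J z = 0) ∧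
      ∀ z, S z = 0 → J z = 0 → z = 0 := by
  obtain ⟨C, hC⟩ := S.range.exists_isCompl
  obtain ⟨N', hN⟩ := S.ker.exists_isCompl
  have hrank : Module.finrank 𝕜 S.ker = Module.finrank 𝕜 C := by
    have h1 := S.finrank_range_add_finrank_ker
    have h2 := Submodule.finrank_add_eq_of_isCompl hC
    omega
  let e : S.ker ≃ₗ[𝕜] C := LinearEquiv.ofFinrankEq _ _ hrank
  refine ⟨C.subtype ∘ₗ e.toLinearMap ∘ₗ S.ker.projectionOnto N' hN, fun x z h => ?_,
    fun z hz hJ => ?_⟩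
  · have h1 : S x = 0 := by
      refine (Submodule.disjoint_def.1 hC.disjoint) _ ⟨x, rfl⟩ ?_
      rw [eq_neg_of_add_eq_zero_left h]
      exact C.neg_mem (Submodule.coe_mem _)
    exact ⟨h1, by simpa [h1] using h⟩
  · have h1 : S.ker.projectionOnto N' hN z = ⟨z, hz⟩ :=
      Submodule.projectionOnto_apply_left hN ⟨z, hz⟩
    have h2 : (e ⟨z, hz⟩ : V) = 0 := by simpa [h1] using hJ
    have h3 : e ⟨z, hz⟩ = 0 := Subtype.ext h2
    exact congrArg Subtype.val (e.map_eq_zero_iff.1 h3)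

/-- If the column `(T, S)` is left invertible and its second component acts on a finite-dimensional
space, then `S + L T` is invertible for some `L`. -/
theorem exists_equiv_add_comp_of_finiteDimensional {𝕜 X Y : Type*} [RCLike 𝕜]
    [NormedAddCommGroup X] [NormedSpace 𝕜 X] [NormedAddCommGroup Y] [NormedSpace 𝕜 Y]
    [FiniteDimensional 𝕜 Y] (T : Y →L[𝕜] X) (S : Y →L[𝕜] Y) (M : X →L[𝕜] Y) (N : Y →L[𝕜] Y)
    (h : ∀ y, M (T y) + N (S y) = y) :
    ∃ (L : X →L[𝕜] Y) (G : Y ≃L[𝕜] Y), ∀ y, G y = S y + L (T y) := by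
  obtain ⟨J, hJ, hJ'⟩ := (S : Y →ₗ[𝕜] Y).exists_ker_correction
  -- On the kernel of `S` the hypothesis reads `M T y = y`, so there `L T` acts as `J`.
  let L : X →L[𝕜] Y := LinearMap.toContinuousLinearMap J ∘L M
  let A : Y →ₗ[𝕜] Y := (S + L ∘L T : Y →L[𝕜] Y)
  have hA : Function.Injective A := by
    rw [injective_iff_map_eq_zero]
    intro y hy
    obtain ⟨h1, h2⟩ := hJ y (M (T y)) hy
    have h3 : M (T y) = y := by
      have h4 : S y = 0 := h1
      simpa [h4] using h y
    rw [h3] at h2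
    exact hJ' y h1 h2
  exact ⟨L, (LinearEquiv.ofInjectiveEndo A hA).toContinuousLinearEquiv, fun y => rfl⟩

/-! ### Completion to an invertible operator in infinite dimension. -/

section Hilbert

variable {𝕜 : Type*} [RCLike 𝕜] {X Y : Type*}
  [NormedAddCommGroup X] [InnerProductSpace 𝕜 X] [CompleteSpace X]
  [NormedAddCommGroup Y] [InnerProductSpace 𝕜 Y] [CompleteSpace Y]

/-- The identity of an infinite-dimensional separable Hilbert space is the sum of two idempotents,
each of which factors the identity. -/
theorem exists_splitting_id [TopologicalSpace.SeparableSpace Y] (hY : ¬ FiniteDimensional 𝕜 Y) :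
    ∃ i j p q : Y →L[𝕜] Y, (∀ y, p (i y) = y) ∧ (∀ y, q (j y) = y) ∧
      ∀ y, i (p y) + j (q y) = y := by
  have hYY : ¬ FiniteDimensional 𝕜 (WithLp 2 (Y × Y)) := fun h => hY <| by
    have := Module.Finite.equiv (WithLp.linearEquiv 2 𝕜 (Y × Y))
    exact Module.Finite.of_surjective (LinearMap.fst 𝕜 Y Y) LinearMap.fst_surjective
  have : TopologicalSpace.SeparableSpace (WithLp 2 (Y × Y)) :=
    (WithLp.prodContinuousLinearEquiv 2 𝕜 Y Y).symm.surjective.denseRange.separableSpace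
      (WithLp.prodContinuousLinearEquiv 2 𝕜 Y Y).symm.continuous
  obtain ⟨e₀⟩ := nonempty_linearIsometryEquiv_of_separable (𝕜 := 𝕜) hY hYY
  let e : Y ≃L[𝕜] Y × Y :=
    e₀.toContinuousLinearEquiv.trans (WithLp.prodContinuousLinearEquiv 2 𝕜 Y Y)
  refine ⟨(e.symm : Y × Y →L[𝕜] Y) ∘L .inl 𝕜 Y Y, (e.symm : Y × Y →L[𝕜] Y) ∘L .inr 𝕜 Y Y,
    .fst 𝕜 Y Y ∘L (e : Y →L[𝕜] Y × Y), .snd 𝕜 Y Y ∘L (e : Y →L[𝕜] Y × Y), ?_, ?_, ?_⟩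
  · intro y; simp
  · intro y; simp
  · intro y
    change e.symm ((e y).1, 0) + e.symm (0, (e y).2) = y
    rw [← map_add, e.symm_apply_eq]
    simp

/-- A left invertible operator on a separable infinite-dimensional Hilbert space becomes invertible
after adding a suitable left multiple of a given noncompact operator. -/
theorem exists_equiv_add_comp_of_leftInverse [TopologicalSpace.SeparableSpace Y]
    (hY : ¬ FiniteDimensional 𝕜 Y) (T : Y →L[𝕜] X) (hT : ¬ IsCompactOperator T)
    (S M : Y →L[𝕜] Y) (hM : ∀ y, M (S y) = y) :
    ∃ (L : X →L[𝕜] Y) (G : Y ≃L[𝕜] Y), ∀ y, G y = S y + L (T y) := by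
  obtain ⟨P, R, hR⟩ := exists_factorization_id_of_not_isCompactOperator hY T hT
  -- `D` is an idempotent with kernel `ran P`, and `F` below is an idempotent onto `S (ran D)`. The
  -- idea is to keep `S` on `ran D` and to redefine it on `ran P` as an isomorphism onto `ker F`.
  let D : Y →L[𝕜] Y := .id 𝕜 Y - P ∘L R ∘L T
  have hD : ∀ y, D y = y - P (R (T y)) := fun y => rfl
  have hDP : ∀ y, D (P y) = 0 := fun y => by rw [hD, hR, sub_self]
  have hRTD : ∀ y, R (T (D y)) = 0 := fun y => by rw [hD, map_sub, map_sub, hR, sub_self]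
  have hDD : ∀ y, D (D y) = D y := fun y => by rw [hD (D y), hRTD, map_zero, sub_zero]
  let F : Y →L[𝕜] Y := S ∘L D ∘L M
  have hF : ∀ y, F y = S (D (M y)) := fun y => rfl
  have hFSD : ∀ y, F (S (D y)) = S (D y) := fun y => by rw [hF, hM, hDD]
  have hFF : ∀ y, F (F y) = F y := fun y => by rw [hF y, hFSD]
  let N : Submodule 𝕜 Y := (F : Y →ₗ[𝕜] Y).ker
  have hNmem : ∀ y, y ∈ N ↔ F y = 0 := fun y => Iff.rfl
  have hNclosed : IsClosed (N : Set Y) := F.isClosed_ker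
  have : CompleteSpace N := hNclosed.completeSpace_coe
  have : SecondCountableTopology Y := UniformSpace.secondCountable_of_separable Y
  have hN : ¬ FiniteDimensional 𝕜 N := fun h => hY <| by
    -- `S P` embeds `Y` into `ker F`, so `ker F` is isomorphic to `Y`.
    let g : Y →ₗ[𝕜] N := (S ∘L P : Y →L[𝕜] Y).toLinearMap.codRestrict N fun y => by
      change S (D (M (S (P y)))) = 0
      rw [hM, hDP, map_zero]
    refine Module.Finite.of_injective g fun a b hab => ?_
    have h1 : S (P a) = S (P b) := congrArg Subtype.val hab
    have h2 : P a = P b := by rw [← hM (P a), h1, hM]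
    rw [← hR a, h2, hR]
  obtain ⟨J⟩ := nonempty_linearIsometryEquiv_of_separable (𝕜 := 𝕜) hY hN
  let J' : Y →L[𝕜] Y := N.subtypeL ∘L (J.toContinuousLinearEquiv : Y →L[𝕜] N)
  have hJ' : ∀ y, J' y = J y := fun y => rfl
  let L : X →L[𝕜] Y := (J' - S ∘L P) ∘L R
  have hG : ∀ y, (S + L ∘L T) y = S (D y) + J' (R (T y)) := fun y => by
    simp [L, hD]; abel
  have hFJ : ∀ y, F (J' y) = 0 := fun y => (hNmem _).1 (J y).2
  have hinj : Function.Injective (S + L ∘L T) := by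
    rw [injective_iff_map_eq_zero]
    intro y hy
    rw [hG] at hy
    have h1 : S (D y) = 0 := by
      have := congrArg F hy
      rwa [map_add, hFSD, hFJ, add_zero, map_zero] at this
    have h2 : J (R (T y)) = 0 := Subtype.ext (by rwa [h1, zero_add, hJ'] at hy)
    have h3 : R (T y) = 0 := by simpa using h2
    have h4 : D y = 0 := by rw [← hM (D y), h1, map_zero]
    rw [hD, h3, map_zero, sub_zero] at h4
    exact h4
  have hsurj : Function.Surjective (S + L ∘L T) := by
    intro z
    have hz : z - F z ∈ N := by rw [hNmem, map_sub, hFF, sub_self]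
    refine ⟨D (M z) + P (J.symm ⟨z - F z, hz⟩), ?_⟩
    rw [hG, map_add D, hDD, hDP, map_add T, map_add R, hRTD, hR, hJ', add_zero, zero_add,
      J.apply_symm_apply, ← hF]
    simp
  exact ⟨L, ContinuousLinearEquiv.ofBijective (S + L ∘L T) (LinearMap.ker_eq_bot.2 hinj)
    (LinearMap.range_eq_top.2 hsurj), fun y => rfl⟩

/-- If the column `(T, S)` is left invertible, `T` is not compact and the range of `S` is annihilated
by a right invertible operator, then `S + L T` is invertible for some `L`. -/
theorem exists_equiv_add_comp_of_annihilator [TopologicalSpace.SeparableSpace X]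
    [TopologicalSpace.SeparableSpace Y] (hX : ¬ FiniteDimensional 𝕜 X)
    (hY : ¬ FiniteDimensional 𝕜 Y) (T : Y →L[𝕜] X) (hT : ¬ IsCompactOperator T) (S : Y →L[𝕜] Y)
    (M : X →L[𝕜] Y) (N : Y →L[𝕜] Y) (h : ∀ y, M (T y) + N (S y) = y) (R Q : Y →L[𝕜] Y)
    (hRQ : ∀ y, R (Q y) = y) (hRS : ∀ y, R (S y) = 0) :
    ∃ (L : X →L[𝕜] Y) (G : Y ≃L[𝕜] Y), ∀ y, G y = S y + L (T y) := by
  obtain ⟨J⟩ := nonempty_linearIsometryEquiv_of_separable (𝕜 := 𝕜) hX hY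
  let J' : X →L[𝕜] Y := (J.toContinuousLinearEquiv : X →L[𝕜] Y)
  let Ji : Y →L[𝕜] X := (J.symm.toContinuousLinearEquiv : Y →L[𝕜] X)
  have hJ : ∀ x, Ji (J' x) = x := J.symm_apply_apply
  -- `R` reads `J' T y` off `(S + Q J' T) y`, and `id - Q R` reads off `S y`; together they
  -- determine `y`.
  obtain ⟨L, G, hG⟩ := exists_equiv_add_comp_of_leftInverse hY T hT (S + Q ∘L J' ∘L T)
    (M ∘L Ji ∘L R + N ∘L (.id 𝕜 Y - Q ∘L R)) fun y => by
      simp [hRQ, hRS, hJ, h]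
  exact ⟨L + Q ∘L J', G, fun y => by rw [hG]; simp; abel⟩

variable [TopologicalSpace.SeparableSpace X] [TopologicalSpace.SeparableSpace Y]
  {U : X →L[𝕜] X} {V : Y →L[𝕜] Y}

/-- Matricial coupling through an operator with noncompact off-diagonal blocks yields a Schur
coupling. -/
theorem schurCoupled_of_not_isCompactOperator (hX : ¬ FiniteDimensional 𝕜 X)
    (hY : ¬ FiniteDimensional 𝕜 Y) (W : (X × Y) ≃L[𝕜] (X × Y))
    (hU : ∀ x, (W (x, 0)).1 = U x) (hV : ∀ y, (W.symm (0, y)).2 = V y)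
    (h₁₂ : ¬ IsCompactOperator fun y : Y => (W (0, y)).1)
    (h₂₁ : ¬ IsCompactOperator fun x : X => (W (x, 0)).2) : SchurCoupled U V := by
  let W₀ : (X × Y) →L[𝕜] (X × Y) := W
  let U₁₂ : Y →L[𝕜] X := .fst 𝕜 X Y ∘L W₀ ∘L .inr 𝕜 X Y
  let U₂₁ : X →L[𝕜] Y := .snd 𝕜 X Y ∘L W₀ ∘L .inl 𝕜 X Y
  let U₂₂ : Y →L[𝕜] Y := .snd 𝕜 X Y ∘L W₀ ∘L .inr 𝕜 X Y
  have hW : ∀ x y, W (x, y) = (U x + U₁₂ y, U₂₁ x + U₂₂ y) := by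
    intro x y
    have : ((x, y) : X × Y) = (x, 0) + (0, y) := by simp
    rw [this, map_add, ← hU]
    rfl
  obtain ⟨P, R, hR⟩ := exists_factorization_id_of_not_isCompactOperator hY U₂₁ h₂₁
  obtain ⟨i, j, p, q, hpi, hqj, hij⟩ := exists_splitting_id (𝕜 := 𝕜) hY
  -- It suffices to cancel a compression of `R U₂₂` while keeping the column noncompact.
  have main : ∀ a b : Y →L[𝕜] Y, (∀ y, b (a y) = y) →
      (¬ IsCompactOperator (U₁₂ - U ∘L P ∘L a ∘L b ∘L R ∘L U₂₂)) → SchurCoupled U V := by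
    intro a b hba hT
    -- Since `R U₂₁ P = id` and `b a = id`, this `Z` gives `b R (U₂₂ + U₂₁ Z) = 0`, and `b R` has
    -- right inverse `U₂₁ P a`.
    let Z : Y →L[𝕜] X := -(P ∘L a ∘L b ∘L R ∘L U₂₂)
    have hTZ : U₁₂ + U ∘L Z = U₁₂ - U ∘L P ∘L a ∘L b ∘L R ∘L U₂₂ := by
      ext y; simp [Z, sub_eq_add_neg]
    let M : (X × Y) →L[𝕜] Y := .snd 𝕜 X Y ∘L (W.symm : (X × Y) →L[𝕜] (X × Y))
    obtain ⟨L, G, hG⟩ := exists_equiv_add_comp_of_annihilator hX hY (U₁₂ + U ∘L Z) (by rwa [hTZ])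
      (U₂₂ + U₂₁ ∘L Z) (M ∘L .inl 𝕜 X Y) (M ∘L .inr 𝕜 X Y) (fun y => by
        have e : ((U₁₂ + U ∘L Z) y, (U₂₂ + U₂₁ ∘L Z) y) = W (Z y, y) := by
          rw [hW]; simp [add_comm]
        change M ((U₁₂ + U ∘L Z) y, 0) + M (0, (U₂₂ + U₂₁ ∘L Z) y) = y
        rw [← map_add, Prod.mk_add_mk, add_zero, zero_add, e]
        change (W.symm (W (Z y, y))).2 = y
        rw [W.symm_apply_apply])
      (b ∘L R) (U₂₁ ∘L P ∘L a) (fun y => by simp [hR, hba])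
      (fun y => by simp [Z, hR, hba])
    obtain ⟨W', hW', hW's⟩ := W.exists_shear L Z
    refine schurCoupled_of_isInvertible_block W' (fun x => ?_) (fun y => (hW's y).trans (hV y)) G
      fun y => ?_
    · rw [hW', map_zero, add_zero, hU]
    · rw [hG, hW', hW]; simp [add_comm]
  by_contra hcon
  -- As `i p + j q = id`, the operators for `(i, p)` and `(j, q)` minus the one for `(id, id)` give
  -- `U₁₂`; they cannot all be compact.
  have h1 : IsCompactOperator (U₁₂ - U ∘L P ∘L i ∘L p ∘L R ∘L U₂₂) := by
    by_contra h; exact hcon (main i p hpi h)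
  have h2 : IsCompactOperator (U₁₂ - U ∘L P ∘L j ∘L q ∘L R ∘L U₂₂) := by
    by_contra h; exact hcon (main j q hqj h)
  have h3 : IsCompactOperator (U₁₂ - U ∘L P ∘L (.id 𝕜 Y) ∘L (.id 𝕜 Y) ∘L R ∘L U₂₂) := by
    by_contra h; exact hcon (main _ _ (fun _ => rfl) h)
  refine h₁₂ (((h1.add h2).sub h3).of_forall_eq fun y => ?_)
  have e : U (P (R (U₂₂ y))) = U (P (i (p (R (U₂₂ y))))) + U (P (j (q (R (U₂₂ y))))) := by
    rw [← map_add, ← map_add, hij]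
  change _ = U₁₂ y
  simp only [Pi.sub_apply, Pi.add_apply, sub_apply,
    ContinuousLinearMap.comp_apply, ContinuousLinearMap.id_apply, e]
  abel

/-- Matricially coupled operators on infinite-dimensional separable Hilbert spaces are Schur
coupled. -/
theorem MatriciallyCoupled.schurCoupled_of_infinite (hX : ¬ FiniteDimensional 𝕜 X)
    (hY : ¬ FiniteDimensional 𝕜 Y) (h : MatriciallyCoupled U V) : SchurCoupled U V := by
  obtain ⟨W, hU', hV'⟩ := h
  have hU : ∀ x, (W (x, 0)).1 = U x := fun x => by rw [hU']; rfl
  have hV : ∀ y, (W.symm (0, y)).2 = V y := fun y => by rw [hV']; rfl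
  let Wi : (X × Y) →L[𝕜] (X × Y) := W.symm
  let U₁₂ : Y →L[𝕜] X := .fst 𝕜 X Y ∘L (W : (X × Y) →L[𝕜] (X × Y)) ∘L .inr 𝕜 X Y
  let U₂₁ : X →L[𝕜] Y := .snd 𝕜 X Y ∘L (W : (X × Y) →L[𝕜] (X × Y)) ∘L .inl 𝕜 X Y
  let V₁₁ : X →L[𝕜] X := .fst 𝕜 X Y ∘L Wi ∘L .inl 𝕜 X Y
  let V₁₂ : Y →L[𝕜] X := .fst 𝕜 X Y ∘L Wi ∘L .inr 𝕜 X Y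
  let V₂₁ : X →L[𝕜] Y := .snd 𝕜 X Y ∘L Wi ∘L .inl 𝕜 X Y
  have hid : ¬ IsCompactOperator (id : X → X) := fun h =>
    hX (isCompactOperator_id_iff_finiteDimensional.1 h)
  have hcol : ∀ x, V₁₁ (U x) + V₁₂ (U₂₁ x) = x := fun x => by
    change (W.symm (U x, 0)).1 + (W.symm (0, (W (x, 0)).2)).1 = x
    rw [← Prod.fst_add, ← map_add, ← hU]
    simp
  have hrow : ∀ x, U (V₁₁ x) + U₁₂ (V₂₁ x) = x := fun x => by
    change U (W.symm (x, 0)).1 + (W (0, (W.symm (x, 0)).2)).1 = x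
    rw [← hU, ← Prod.fst_add, ← map_add]
    simp
  obtain ⟨J⟩ := nonempty_linearIsometryEquiv_of_separable (𝕜 := 𝕜) hX hY
  let J' : X →L[𝕜] Y := (J.toContinuousLinearEquiv : X →L[𝕜] Y)
  let Ji : Y →L[𝕜] X := (J.symm.toContinuousLinearEquiv : Y →L[𝕜] X)
  have hJ : ∀ x, Ji (J' x) = x := J.symm_apply_apply
  -- Otherwise `L = 0` and `L = J'` make `U₂₁` and `U` compact, and then so is the identity `V₁₁ U +
  -- V₁₂ U₂₁`. The choice of `Z` is dual.
  obtain ⟨L, hL⟩ : ∃ L : X →L[𝕜] Y, ¬ IsCompactOperator (U₂₁ + L ∘L U) := by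
    by_contra! hcon
    have h1 : IsCompactOperator U₂₁ := by simpa using hcon 0
    have h2 : IsCompactOperator U := by
      exact (((hcon J').sub h1).clm_comp Ji).of_forall_eq fun x => by simp [hJ]
    exact hid (IsCompactOperator.of_forall_eq ((h2.clm_comp V₁₁).add (h1.clm_comp V₁₂))
      hcol)
  obtain ⟨Z, hZ⟩ : ∃ Z : Y →L[𝕜] X, ¬ IsCompactOperator (U₁₂ + U ∘L Z) := by
    by_contra! hcon
    have h1 : IsCompactOperator U₁₂ := by simpa using hcon 0
    have h2 : IsCompactOperator U := by
      exact (((hcon Ji).sub h1).comp_clm J').of_forall_eq fun x => by simp [hJ]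
    exact hid (IsCompactOperator.of_forall_eq ((h2.comp_clm V₁₁).add (h1.comp_clm V₂₁))
      hrow)
  obtain ⟨W', hW', hW's⟩ := W.exists_shear L Z
  refine schurCoupled_of_not_isCompactOperator hX hY W' (fun x => ?_)
    (fun y => (hW's y).trans (hV y)) ?_ ?_
  · rw [hW', map_zero, add_zero, hU]
  · refine fun h => hZ (h.of_forall_eq fun y => ?_)
    have e : ((0 + Z y, y) : X × Y) = (0, y) + (Z y, 0) := by simp
    rw [hW', e, map_add, Prod.fst_add, hU]
    rfl
  · refine fun h => hL (h.of_forall_eq fun x => ?_)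
    rw [hW', map_zero, add_zero, hU]
    rfl

end Hilbert

/-! ### The finite-dimensional case and the conclusion. -/

/-- Matricially coupled operators, the second of which acts on a finite-dimensional space, are Schur
coupled. -/
theorem MatriciallyCoupled.schurCoupled_of_finiteDimensional {𝕜 X Y : Type*} [RCLike 𝕜]
    [NormedAddCommGroup X] [NormedSpace 𝕜 X] [NormedAddCommGroup Y] [NormedSpace 𝕜 Y]
    [FiniteDimensional 𝕜 Y] {U : X →L[𝕜] X} {V : Y →L[𝕜] Y} (h : MatriciallyCoupled U V) :
    SchurCoupled U V := by
  obtain ⟨W, hU', hV'⟩ := h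
  have hU : ∀ x, (W (x, 0)).1 = U x := fun x => by rw [hU']; rfl
  have hV : ∀ y, (W.symm (0, y)).2 = V y := fun y => by rw [hV']; rfl
  let C : Y →L[𝕜] (X × Y) := (W : (X × Y) →L[𝕜] (X × Y)) ∘L .inr 𝕜 X Y
  let M : (X × Y) →L[𝕜] Y := .snd 𝕜 X Y ∘L (W.symm : (X × Y) →L[𝕜] (X × Y))
  obtain ⟨L, G, hG⟩ := exists_equiv_add_comp_of_finiteDimensional (.fst 𝕜 X Y ∘L C)
    (.snd 𝕜 X Y ∘L C) (M ∘L .inl 𝕜 X Y) (M ∘L .inr 𝕜 X Y) fun y => by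
      change M ((W (0, y)).1, 0) + M (0, (W (0, y)).2) = y
      rw [← map_add, Prod.mk_add_mk, add_zero, zero_add]
      change (W.symm (W (0, y))).2 = y
      rw [W.symm_apply_apply]
  obtain ⟨W', hW', hW's⟩ := W.exists_shear L 0
  refine schurCoupled_of_isInvertible_block W' (fun x => ?_) (fun y => (hW's y).trans (hV y)) G
    fun y => ?_
  · rw [hW', map_zero, add_zero, hU]
  · rw [hG, hW']; simp [C]

theorem theorem1p2 {𝕜 : Type*} [RCLike 𝕜] {X Y : Type u}
    [NormedAddCommGroup X] [InnerProductSpace 𝕜 X] [CompleteSpace X]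
    [TopologicalSpace.SeparableSpace X]
    [NormedAddCommGroup Y] [InnerProductSpace 𝕜 Y] [CompleteSpace Y]
    [TopologicalSpace.SeparableSpace Y]
    (U : X →L[𝕜] X) (V : Y →L[𝕜] Y) :
    (SchurCoupled U V ↔ MatriciallyCoupled U V) ∧
      (MatriciallyCoupled U V ↔ EquivalentAfterExtension U V) ∧
      (EquivalentAfterExtension U V ↔ SchurCoupled U V) := by
  have h₁ : MatriciallyCoupled U V → SchurCoupled U V := by
    intro h
    by_cases hY : FiniteDimensional 𝕜 Y
    · exact h.schurCoupled_of_finiteDimensional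
    by_cases hX : FiniteDimensional 𝕜 X
    · exact h.symm.schurCoupled_of_finiteDimensional.symm
    exact h.schurCoupled_of_infinite hX hY
  exact ⟨⟨SchurCoupled.matriciallyCoupled, h₁⟩,
    ⟨MatriciallyCoupled.equivalentAfterExtension, EquivalentAfterExtension.matriciallyCoupled⟩,
    ⟨fun h => h₁ h.matriciallyCoupled,
      fun h => h.matriciallyCoupled.equivalentAfterExtension⟩⟩
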